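/- All systems are finite-dimensional, and a quantum channel is a completely positive trace-preserving linear map. For a channel $\mathcal{N}_{A\to B}$ let $\Gamma^{\mathcal{N}}_{RB}:=\sum_{i,j}|i\rangle\langle j|_R\otimes\mathcal{N}(|i\rangle\langle j|_A)$ be its Choi operator, with $R\cong A$. The Belavkin–Staszewski relative entropy of channels $\mathcal{N}_{A\to B}$ and $\mathcal{M}_{A\to B}$ is $$\widehat D(\mathcal{N}\Vert\mathcal{M}):=\left\Vert \operatorname{Tr}_B\!\left[(\Gamma^{\mathcal{N}}_{RB})^{1/2}\ln\!\left((\Gamma^{\mathcal{N}}_{RB})^{1/2}(\Gamma^{\mathcal{M}}_{RB})^{-1}(\Gamma^{\mathcal{N}}_{RB})^{1/2}\right)(\Gamma^{\mathcal{N}}_{RB})^{1/2}\right]\right\Vert_\infty$$ if $\operatorname{supp}\Gamma^{\mathcal{N}}_{RB}\subseteq\operatorname{supp}\Gamma^{\mathcal{M}}_{RB}$, and $+\infty$ otherwise; the inverse and the logarithm are taken on supports. An adaptive discrimination strategy with $n\ge 1$ channel uses consists of a state $\rho_{R_1A_1}$, channels $\mathcal{S}^i_{R_iB_i\to R_{i+1}A_{i+1}}$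 for $1\le i\le n-1$ (with finite-dimensional memory systems $R_i$ of arbitrary dimension), and an operator $0\le\Lambda\le I$ on $R_nB_n$. Let $\omega^{\mathcal{N}}_{R_nB_n}:=(\mathcal{N}\circ\mathcal{S}^{n-1}\circ\cdots\circ\mathcal{S}^1\circ\mathcal{N})(\rho_{R_1A_1})$ be its final state when the unknown channel is $\mathcal{N}$, let $\omega^{\mathcal{M}}_{R_nB_n}$ be the corresponding final state when it is $\mathcal{M}$, and put $\alpha_n:=\operatorname{Tr}[(I-\Lambda)\omega^{\mathcal{N}}_{R_nB_n}]$ and $\beta_n:=\operatorname{Tr}[\Lambda\omega^{\mathcal{M}}_{R_nB_n}]$. With $-\ln 0:=+\infty$ and the suprema below taken over all such strategies, let $$B_n(r,\mathcal{N},\mathcal{M}):=\sup\left\{-\tfrac1n\ln\alpha_n \;:\; -\tfrac1n\ln\beta_n\ge r\right\},\qquad \overline B(r,\mathcal{N},\mathcal{M}):=\limsup_{n\to\infty}B_n(r,\mathcal{N},\mathcal{M}).$$ **Proposition (Belavkin–Staszewski divergence sphere bound).** Let $\mathcal{N}_{A\to B}$ and $\mathcal{M}_{A\to B}$ be quantum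 channels and let $r>0$ be a real number different from the critical rate $$r_0:=\inf\{\widehat D(\mathcal{T}\Vert\mathcal{M}) \;:\; \mathcal{T}_{A\to B}\text{ a channel with }\widehat D(\mathcal{T}\Vert\mathcal{N})<\infty\}\in[0,\infty].$$ Then $$\overline B(r,\mathcal{N},\mathcal{M})\le\inf_{\mathcal{T}_{A\to B}:\,\widehat D(\mathcal{T}\Vert\mathcal{M})\le r}\widehat D(\mathcal{T}\Vert\mathcal{N}),$$ where $\mathcal{T}$ ranges over quantum channels from $A$ to $B$ and the infimum of the empty set is $+\infty$. (If $\operatorname{supp}\Gamma^{\mathcal{M}}_{RB}\subseteq\operatorname{supp}\Gamma^{\mathcal{N}}_{RB}$, then $r_0=0$, so that every $r>0$ is allowed.) -/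

import Mathlib

open Filter
open scoped Matrix ComplexOrder

namespace QDisc

noncomputable section

/-- A quantum state: a positive semi-definite matrix of unit trace. -/
def IsState {ι : Type*} [Fintype ι] (ρ : Matrix ι ι ℂ) : Prop :=
  ρ.PosSemidef ∧ ρ.trace = 1

/-- The map `id_R ⊗ Φ` on matrices over the composite system `R × A`. -/
def ampliate {A B : Type*} (R : Type*)
    (Φ : Matrix A A ℂ →ₗ[ℂ] Matrix B B ℂ) (X : Matrix (R × A) (R × A) ℂ) :
    Matrix (R × B) (R × B) ℂ :=
  Matrix.of fun p q => Φ (Matrix.of fun a a' => X (p.1, a) (q.1, a')) p.2 q.2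

/-- A quantum channel with finite-dimensional input `A` and output `B` (the index types label
orthonormal bases): a completely positive, trace-preserving linear map. -/
structure Channel (A B : Type*) [Fintype A] [Fintype B] where
  toLin : Matrix A A ℂ →ₗ[ℂ] Matrix B B ℂ
  completelyPositive : ∀ (k : ℕ) (X : Matrix (Fin k × A) (Fin k × A) ℂ),
    X.PosSemidef → (ampliate (Fin k) toLin X).PosSemidef
  tracePreserving : ∀ X : Matrix A A ℂ, (toLin X).trace = X.trace

/-- The Choi operator `∑ i j, |i⟩⟨j| ⊗ N(|i⟩⟨j|)`. -/
def choi {A B : Type*} [Fintype A] [DecidableEq A] [Fintype B] (N : Channel A B) :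
    Matrix (A × B) (A × B) ℂ :=
  Matrix.of fun p q => N.toLin (Matrix.single p.1 q.1 1) p.2 q.2

/-- The partial trace over the second factor. -/
def partialTraceRight {A B : Type*} [Fintype B] (X : Matrix (A × B) (A × B) ℂ) :
    Matrix A A ℂ :=
  Matrix.of fun i j => ∑ b, X (i, b) (j, b)

/-- The support of a matrix: the orthogonal complement of its kernel. -/
def supp {ι : Type*} [Fintype ι] [DecidableEq ι] (X : Matrix ι ι ℂ) :
    Submodule ℂ (EuclideanSpace ℂ ι) :=
  (LinearMap.ker (Matrix.toEuclideanLin X))ᗮ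

/-- The operator (spectral) norm of a matrix. -/
def opNorm {ι : Type*} [Fintype ι] [DecidableEq ι] (X : Matrix ι ι ℂ) : ℝ :=
  ‖Matrix.toEuclideanCLM (n := ι) (𝕜 := ℂ) X‖

/-- The operator `X^{1/2} ln(X^{1/2} Y⁻¹ X^{1/2}) X^{1/2}` for positive semi-definite `X`, `Y`.
As `0⁻¹ = 0` and `Real.log 0 = 0`, the functional calculus inverts `Y` on its support (the
Moore-Penrose inverse) and evaluates the logarithm on the support of its argument. -/
def bsOperator {ι : Type*} [Fintype ι] [DecidableEq ι] (X Y : Matrix ι ι ℂ) :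
    Matrix ι ι ℂ :=
  cfc Real.sqrt X *
    cfc Real.log (cfc Real.sqrt X * cfc (fun x : ℝ => x⁻¹) Y * cfc Real.sqrt X) *
    cfc Real.sqrt X

open Classical in
/-- The Belavkin-Staszewski relative entropy of the channels `N` and `M`, in nats. -/
def bsDiv {A B : Type*} [Fintype A] [DecidableEq A] [Fintype B] [DecidableEq B]
    (N M : Channel A B) : EReal :=
  if supp (choi N) ≤ supp (choi M) then
    ((opNorm (partialTraceRight (bsOperator (choi N) (choi M))) : ℝ) : EReal)
  else ⊤

/-- `Protocol A B n d` is the type of adaptive protocols, without the final measurement, that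
call an unknown channel from `A` to `B` exactly `n ≥ 1` times and end with a memory system `R_n`
of dimension `d`: an input state of `R_1 A_1`, and channels from `R_i B_i` to `R_{i+1} A_{i+1}`
between consecutive calls. -/
inductive Protocol (A B : Type*) [Fintype A] [Fintype B] : ℕ → ℕ → Type _
  | start {d : ℕ} (ρ : Matrix (Fin d × A) (Fin d × A) ℂ) (hρ : IsState ρ) : Protocol A B 1 d
  | step {n d d' : ℕ} (P : Protocol A B n d) (S : Channel (Fin d × B) (Fin d' × A)) :
      Protocol A B (n + 1) d'

/-- The final state on `R_n B_n` when the unknown channel is `N`. -/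
def Protocol.finalState {A B : Type*} [Fintype A] [Fintype B] (N : Channel A B) :
    {n d : ℕ} → Protocol A B n d → Matrix (Fin d × B) (Fin d × B) ℂ
  | _, _, .start ρ _ => ampliate _ N.toLin ρ
  | _, _, .step P S => ampliate _ N.toLin (S.toLin (P.finalState N))

/-- A test `{L, 1 - L}`, where the outcome `L` stands for the decision for the first channel. -/
def IsTest {ι : Type*} [Fintype ι] [DecidableEq ι] (L : Matrix ι ι ℂ) : Prop :=
  L.PosSemidef ∧ (1 - L).PosSemidef

/-- Type I error probability: the unknown channel is `N`, the decision is for the other one. -/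
def typeI {A B : Type*} [Fintype A] [Fintype B] [DecidableEq B] (N : Channel A B) {n d : ℕ}
    (P : Protocol A B n d) (L : Matrix (Fin d × B) (Fin d × B) ℂ) : ℝ :=
  ((1 - L) * P.finalState N).trace.re

/-- Type II error probability: the unknown channel is `M`, the decision is for the other one. -/
def typeII {A B : Type*} [Fintype A] [Fintype B] (M : Channel A B) {n d : ℕ}
    (P : Protocol A B n d) (L : Matrix (Fin d × B) (Fin d × B) ℂ) : ℝ :=
  (L * P.finalState M).trace.re

/-- The exponent `-(1/n) ln x` of a probability `x`, equal to `+∞` at `x = 0` (for `n ≥ 1`). -/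
def errExponent (n : ℕ) (x : ℝ) : EReal :=
  -ENNReal.log (ENNReal.ofReal x) / (n : EReal)

/-- The non-asymptotic Hoeffding exponent: the supremum of the type I exponent over all adaptive
`n`-call strategies, with memories of any finite dimension, whose type II exponent is at
least `r`. -/
def hoeffding {A B : Type*} [Fintype A] [Fintype B] [DecidableEq B]
    (n : ℕ) (r : ℝ) (N M : Channel A B) : EReal :=
  sSup {e : EReal | ∃ (d : ℕ) (P : Protocol A B n d) (L : Matrix (Fin d × B) (Fin d × B) ℂ),
    IsTest L ∧ (r : EReal) ≤ errExponent n (typeII M P L) ∧ e = errExponent n (typeI N P L)}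

/-- The (upper) asymptotic Hoeffding exponent. -/
def hoeffdingUpper {A B : Type*} [Fintype A] [Fintype B] [DecidableEq B]
    (r : ℝ) (N M : Channel A B) : EReal :=
  limsup (fun n : ℕ => hoeffding n r N M) atTop

end

end QDisc

/-! The Belavkin–Staszewski divergence is the cost of a classical reverse test: diagonalising
`K^(-1/2) J K^(-1/2)` writes two Choi operators as `∑ w_k |v_k⟩⟨v_k|` and `∑ |v_k⟩⟨v_k|`
(`exists_reverse_test`). Thus `T = ∑ w_k Φ_k` and `M = ∑ Φ_k` share completely positive maps, and
the relative entropy of the weights on any input state is at most the divergence.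

An adaptive protocol, being linear in each call, expands over sequences of the `Φ_k`, with
likelihood ratio `∏ w`. Its moments of order `1 + s` are bounded call by call, so Markov's
inequality gives an exponential strong converse despite adaptivity
(`HasReverseTest.exists_exp_bound`).

Let `T` have rate below `r` against `M` and rate `c'` against `N`. A test with type II exponent at
least `r` is accepted under `T` with vanishing probability; hence it rejects under `T` with
probability near one, and the strong converse against `N` bounds the type I exponent by `c'`. If the
rate of `T` against `M` equals `r`, a small admixture of a channel with strictly smaller rate
restores the gap; `r ≠ r₀` supplies it. -/

namespace QDisc

/-! ### Functional calculus and the reverse test for pairs of matrices. -/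

section MatrixAnalysis

variable {n : Type*} [Fintype n] [DecidableEq n]

theorem cfc_mul_cfc (A : Matrix n n ℂ) (f g : ℝ → ℝ) :
    cfc f A * cfc g A = cfc (fun x => f x * g x) A :=
  (cfc_mul f g A (A.finite_real_spectrum.continuousOn f)
    (A.finite_real_spectrum.continuousOn g)).symm

theorem isHermitian_cfc (A : Matrix n n ℂ) (f : ℝ → ℝ) : (cfc f A).IsHermitian :=
  cfc_predicate f A

/-- On the spectra of two matrices, any real function agrees with a polynomial. -/
theorem exists_polynomial_cfc_eq (A B : Matrix n n ℂ) (hA : A.IsHermitian) (hB : B.IsHermitian)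
    (f : ℝ → ℝ) : ∃ p : Polynomial ℝ, cfc f A = p.aeval A ∧ cfc f B = p.aeval B := by
  classical
  set s := (A.finite_real_spectrum.union B.finite_real_spectrum).toFinset with hs
  refine ⟨Lagrange.interpolate s id f, ?_, ?_⟩
  · rw [← cfc_polynomial _ A hA]
    refine cfc_congr fun x hx => ?_
    exact (Lagrange.eval_interpolate_at_node (v := id) f (Set.injOn_id _)
      (i := x) (by simp [hs, hx])).symm
  · rw [← cfc_polynomial _ B hB]
    refine cfc_congr fun x hx => ?_
    exact (Lagrange.eval_interpolate_at_node (v := id) f (Set.injOn_id _)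
      (i := x) (by simp [hs, hx])).symm

theorem mul_aeval_of_intertwine {A B Y : Matrix n n ℂ} (h : A * Y = Y * B)
    (p : Polynomial ℝ) : p.aeval A * Y = Y * p.aeval B := by
  have hpow (k : ℕ) : A ^ k * Y = Y * B ^ k := (SemiconjBy.pow_right
    (show SemiconjBy Y B A from h.symm) k).symm
  induction p using Polynomial.induction_on' with
  | add p q hp hq => simp [add_mul, mul_add, hp, hq]
  | monomial k a =>
    simp [Polynomial.aeval_monomial, Algebra.algebraMap_eq_smul_one, hpow]

/-- Functional calculus respects intertwining relations between Hermitian matrices. -/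
theorem cfc_mul_of_intertwine {A B Y : Matrix n n ℂ} (hA : A.IsHermitian) (hB : B.IsHermitian)
    (h : A * Y = Y * B) (f : ℝ → ℝ) : cfc f A * Y = Y * cfc f B := by
  obtain ⟨p, hpA, hpB⟩ := exists_polynomial_cfc_eq A B hA hB f
  rw [hpA, hpB, mul_aeval_of_intertwine h]

theorem cfc_congr_of_posSemidef {A : Matrix n n ℂ} (hA : A.PosSemidef) {f g : ℝ → ℝ}
    (h : ∀ x, 0 ≤ x → f x = g x) : cfc f A = cfc g A := by
  refine cfc_congr fun x hx => h x ?_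
  rw [hA.1.spectrum_real_eq_range_eigenvalues] at hx
  obtain ⟨i, rfl⟩ := hx
  exact hA.eigenvalues_nonneg i

theorem cfc_sqrt_mul_cfc_sqrt {A : Matrix n n ℂ} (hA : A.PosSemidef) :
    cfc Real.sqrt A * cfc Real.sqrt A = A := by
  rw [cfc_mul_cfc, cfc_congr_of_posSemidef hA (g := fun x => x) fun x hx => Real.mul_self_sqrt hx]
  exact cfc_id' ℝ A hA.1.isSelfAdjoint

/-- The functional calculus of a Hermitian matrix as a sum over its eigenvectors. -/
theorem exists_eigenvectors_cfc_eq_sum {A : Matrix n n ℂ} (hA : A.IsHermitian) :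
    ∃ u : n → n → ℂ, ∀ f : ℝ → ℝ,
      cfc f A = ∑ k, (f (hA.eigenvalues k) : ℂ) • Matrix.vecMulVec (u k) (star (u k)) := by
  refine ⟨fun k i => (hA.eigenvectorUnitary : Matrix n n ℂ) i k, fun f => ?_⟩
  rw [hA.cfc_eq, Matrix.IsHermitian.cfc, Unitary.conjStarAlgAut_apply]
  ext i j
  simp [Matrix.mul_apply, Matrix.sum_apply, Matrix.vecMulVec_apply, Matrix.diagonal_apply,
    Matrix.star_apply]
  refine Finset.sum_congr rfl fun k _ => ?_
  ring

theorem mul_vecMulVec_mul_conjTranspose {n : Type*} [Fintype n] (S : Matrix n n ℂ) (u : n → ℂ) :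
    S * Matrix.vecMulVec u (star u) * Sᴴ = Matrix.vecMulVec (S *ᵥ u) (star (S *ᵥ u)) := by
  rw [Matrix.mul_vecMulVec, Matrix.vecMulVec_mul, Matrix.star_mulVec]

/-- Orthogonal complements reverse inclusions, so `ker K ≤ ker J`; the columns of `Q` lie in `ker
K`. -/
theorem mul_eq_zero_of_supp_le {J K : Matrix n n ℂ} (h : supp J ≤ supp K)
    {Q : Matrix n n ℂ} (hQ : K * Q = 0) : J * Q = 0 := by
  have hker : LinearMap.ker (Matrix.toEuclideanLin K) ≤ LinearMap.ker (Matrix.toEuclideanLin J) :=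
    (Submodule.orthogonal_le_orthogonal_iff).1 h
  have key (j : n) : J *ᵥ (fun i => Q i j) = 0 := by
    have h1 : WithLp.toLp 2 (fun i => Q i j) ∈ LinearMap.ker (Matrix.toEuclideanLin K) := by
      rw [LinearMap.mem_ker, Matrix.toLpLin_apply]
      ext i
      exact congrFun (congrFun hQ i) j
    have h2 := hker h1
    rw [LinearMap.mem_ker, Matrix.toLpLin_apply] at h2
    ext i
    exact congrArg (fun x : EuclideanSpace ℂ n => x i) h2
  ext i j
  exact congrFun (key j) i

/-- A pair of positive semi-definite matrices with nested supports is a positive combination, with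
common rank-one matrices, of two non-negative functions whose relative entropy is the trace of the
Belavkin-Staszewski operator. -/
theorem exists_reverse_test {J K : Matrix n n ℂ} (hJ : J.PosSemidef) (hK : K.PosSemidef)
    (h : supp J ≤ supp K) : ∃ (w : n → ℝ) (v : n → n → ℂ), (∀ k, 0 ≤ w k) ∧
      ∑ k, Matrix.vecMulVec (v k) (star (v k)) = K ∧
      ∑ k, (w k : ℂ) • Matrix.vecMulVec (v k) (star (v k)) = J ∧
      ∑ k, ((w k * Real.log (w k) : ℝ) : ℂ) • Matrix.vecMulVec (v k) (star (v k)) =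
        bsOperator J K := by
  set S := cfc Real.sqrt K with hS
  set G := cfc (fun x : ℝ => (√x)⁻¹) K with hG
  set H := cfc Real.sqrt J with hH
  have hSh : Sᴴ = S := isHermitian_cfc K _
  have hGh : Gᴴ = G := isHermitian_cfc K _
  have hHh : Hᴴ = H := isHermitian_cfc J _
  have hHH : H * H = J := cfc_sqrt_mul_cfc_sqrt hJ
  have hSS : S * S = K := cfc_sqrt_mul_cfc_sqrt hK
  have hSG : S * G = G * S := by
    rw [hS, hG, cfc_mul_cfc, cfc_mul_cfc]
    simp only [mul_comm]
  have hGG : G * G = cfc (fun x : ℝ => x⁻¹) K := by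
    rw [hG, cfc_mul_cfc]
    refine cfc_congr_of_posSemidef hK fun x hx => ?_
    rw [← mul_inv, Real.mul_self_sqrt hx]
  have hSSG : S * (S * G) = S := by
    rw [hS, hG, cfc_mul_cfc, cfc_mul_cfc]
    refine cfc_congr_of_posSemidef hK fun x _ => ?_
    by_cases hx : √x = 0
    · simp [hx]
    · field_simp
  -- `S * G` is the projection onto the support of `K`; nested supports make `J`, hence `H = √J`,
  -- vanish on its complement.
  have hKQ : K * (1 - S * G) = 0 := by
    rw [mul_sub, mul_one, ← hSS, mul_assoc, hSSG, sub_self]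
  have hHQ : H * (1 - S * G) = 0 := by
    have := mul_eq_zero_of_supp_le h hKQ
    rw [← hHH] at this
    nth_rewrite 1 [← hHh] at this
    exact Matrix.conjTranspose_mul_self_mul_eq_zero _ _ |>.1 this
  have hHSG : H * S * G = H := by
    rw [mul_sub, mul_one, sub_eq_zero, ← mul_assoc] at hHQ
    exact hHQ.symm
  -- `Y = K^(-1/2) J^(1/2)`: the weights are the eigenvalues of `Y Yᴴ`, and the vectors are its
  -- eigenvectors multiplied by `√K`.
  set Y := G * H with hY
  have hYh : Yᴴ = H * G := by rw [hY, Matrix.conjTranspose_mul, hGh, hHh]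
  have hYhS : Yᴴ * S = H := by rw [hYh, mul_assoc, ← hSG, ← mul_assoc, hHSG]
  have hSY : S * Y = H := by
    have := congrArg Matrix.conjTranspose hYhS
    rwa [Matrix.conjTranspose_mul, Matrix.conjTranspose_conjTranspose, hSh, hHh] at this
  have hX : (Y * Yᴴ).PosSemidef := Matrix.posSemidef_self_mul_conjTranspose Y
  have hX' : (Yᴴ * Y).PosSemidef := Matrix.posSemidef_conjTranspose_mul_self Y
  obtain ⟨u, hu⟩ := exists_eigenvectors_cfc_eq_sum hX.1
  have key (f : ℝ → ℝ) : ∑ k, (f (hX.1.eigenvalues k) : ℂ) •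
      Matrix.vecMulVec (S *ᵥ u k) (star (S *ᵥ u k)) = S * cfc f (Y * Yᴴ) * S := by
    rw [hu f, Finset.mul_sum, Finset.sum_mul]
    refine Finset.sum_congr rfl fun k _ => ?_
    rw [← mul_vecMulVec_mul_conjTranspose, hSh, Matrix.mul_smul, Matrix.smul_mul]
  refine ⟨hX.1.eigenvalues, fun k => S *ᵥ u k, hX.eigenvalues_nonneg, ?_, ?_, ?_⟩
  · have := key (fun _ => 1)
    simp only [Complex.ofReal_one, one_smul] at this
    rw [this, cfc_const_one ℝ _ hX.1.isSelfAdjoint, mul_one, hSS]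
  · rw [key (fun x => x), cfc_id' ℝ _ hX.1.isSelfAdjoint, ← mul_assoc, hSY, mul_assoc, hYhS, hHH]
  -- The eigenvectors produce `log (Y Yᴴ)` while `bsOperator` contains `log (Yᴴ Y)`; the relation
  -- `(Y Yᴴ) Y = Y (Yᴴ Y)` converts one into the other.
  · have hlog : cfc (fun x => x * Real.log x) (Y * Yᴴ) = cfc Real.log (Y * Yᴴ) * (Y * Yᴴ) := by
      have h1 := cfc_mul_cfc (Y * Yᴴ) Real.log (fun x => x)
      rw [cfc_id' ℝ (Y * Yᴴ) hX.1.isSelfAdjoint] at h1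
      rw [h1]
      simp only [mul_comm]
    have hYY : H * (G * G) * H = Yᴴ * Y := by
      rw [hYh, hY]
      simp only [mul_assoc]
    rw [key (fun x => x * Real.log x), hlog, ← mul_assoc (cfc Real.log _),
      cfc_mul_of_intertwine hX.1 hX'.1 (mul_assoc Y Yᴴ Y) Real.log]
    calc S * (Y * cfc Real.log (Yᴴ * Y) * Yᴴ) * S
        = (S * Y) * cfc Real.log (Yᴴ * Y) * (Yᴴ * S) := by simp only [mul_assoc]
      _ = bsOperator J K := by rw [hSY, hYhS, ← hYY, hGG, bsOperator]

/-- The real part of `Tr(ρ Zᵀ)` is at most `‖Z‖ Tr ρ` for positive semi-definite `ρ`. -/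
theorem re_trace_mul_transpose_le {ρ : Matrix n n ℂ} (hρ : ρ.PosSemidef) (Z : Matrix n n ℂ) :
    (ρ * Zᵀ).trace.re ≤ opNorm Z * ρ.trace.re := by
  set R := cfc Real.sqrt ρ with hR
  have hRh : Rᴴ = R := isHermitian_cfc ρ _
  have hRR : R * R = ρ := cfc_sqrt_mul_cfc_sqrt hρ
  have hquad (x : EuclideanSpace ℂ n) :
      (∑ i, ∑ j, x j * Z i j * star (x i)).re ≤ opNorm Z * (∑ i, x i * star (x i)).re := by
    have h1 : ∑ i, ∑ j, x j * Z i j * star (x i) =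
        inner ℂ x (Matrix.toEuclideanCLM (n := n) (𝕜 := ℂ) Z x) := by
      simp [PiLp.inner_apply, Matrix.mulVec, dotProduct, Finset.mul_sum, mul_comm]
    have h2 : (∑ i, x i * star (x i)).re = ‖x‖ * ‖x‖ := by
      rw [← sq, EuclideanSpace.norm_sq_eq]
      simp [Complex.mul_conj, Complex.normSq_eq_norm_sq]
      norm_cast
    rw [h1, h2, ← mul_assoc]
    refine (Complex.re_le_norm _).trans ((norm_inner_le_norm _ _).trans ?_)
    rw [mul_comm]
    exact mul_le_mul_of_nonneg_right (ContinuousLinearMap.le_opNorm _ _) (norm_nonneg _)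
  -- Factoring `ρ = R R` turns the trace into a sum of quadratic forms of `Z` at the rows of `R`.
  have h1 : (ρ * Zᵀ).trace = ∑ k, ∑ i, ∑ j, R k j * Z i j * star (R k i) := by
    rw [← hRR, mul_assoc, Matrix.trace_mul_comm]
    nth_rewrite 2 [← hRh]
    simp [Matrix.trace, Matrix.mul_apply, Finset.sum_mul]
  have h2 : ρ.trace = ∑ k, ∑ i, R k i * star (R k i) := by
    rw [← hRR]
    nth_rewrite 2 [← hRh]
    simp [Matrix.trace, Matrix.mul_apply]
  rw [h1, h2, Complex.re_sum, Complex.re_sum, Finset.mul_sum]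
  exact Finset.sum_le_sum fun k _ => hquad (WithLp.toLp 2 (R k))

end MatrixAnalysis

universe u v

/-! ### Completely positive maps, Choi operators and reverse tests of maps. -/

section ReverseTest

variable {A : Type u} {B : Type v}

/-- Complete positivity of a linear map between matrix algebras. -/
def IsCP (Φ : Matrix A A ℂ →ₗ[ℂ] Matrix B B ℂ) : Prop :=
  ∀ (k : ℕ) (X : Matrix (Fin k × A) (Fin k × A) ℂ),
    X.PosSemidef → (ampliate (Fin k) Φ X).PosSemidef

theorem IsCP.posSemidef_map {Φ : Matrix A A ℂ →ₗ[ℂ] Matrix B B ℂ} (hΦ : IsCP Φ)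
    {X : Matrix A A ℂ} (hX : X.PosSemidef) : (Φ X).PosSemidef :=
  (hΦ 1 (X.submatrix Prod.snd Prod.snd) (hX.submatrix _)).submatrix fun b => ((0 : Fin 1), b)

theorem ampliate_sum {ι R : Type*} (s : Finset ι) (Φ : ι → Matrix A A ℂ →ₗ[ℂ] Matrix B B ℂ)
    (X : Matrix (R × A) (R × A) ℂ) :
    ampliate R (∑ i ∈ s, Φ i) X = ∑ i ∈ s, ampliate R (Φ i) X := by
  ext p q
  simp [ampliate, Matrix.sum_apply, LinearMap.sum_apply]

theorem ampliate_smul {R : Type*} (c : ℂ) (Φ : Matrix A A ℂ →ₗ[ℂ] Matrix B B ℂ)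
    (X : Matrix (R × A) (R × A) ℂ) : ampliate R (c • Φ) X = c • ampliate R Φ X := rfl

theorem ampliate_map_sum {ι R : Type*} (s : Finset ι) (Φ : Matrix A A ℂ →ₗ[ℂ] Matrix B B ℂ)
    (X : ι → Matrix (R × A) (R × A) ℂ) :
    ampliate R Φ (∑ i ∈ s, X i) = ∑ i ∈ s, ampliate R Φ (X i) := by
  ext p q
  have : (Matrix.of fun a a' => (∑ i ∈ s, X i) (p.1, a) (q.1, a')) =
      ∑ i ∈ s, Matrix.of fun a a' => X i (p.1, a) (q.1, a') := by
    ext a a'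
    simp [Matrix.sum_apply]
  rw [ampliate, Matrix.of_apply, this, map_sum]
  simp [ampliate, Matrix.sum_apply]

theorem ampliate_map_smul {R : Type*} (c : ℂ) (Φ : Matrix A A ℂ →ₗ[ℂ] Matrix B B ℂ)
    (X : Matrix (R × A) (R × A) ℂ) : ampliate R Φ (c • X) = c • ampliate R Φ X := by
  ext p q
  have : (Matrix.of fun a a' => (c • X) (p.1, a) (q.1, a')) =
      c • Matrix.of fun a a' => X (p.1, a) (q.1, a') := rfl
  rw [ampliate, Matrix.of_apply, this, map_smul]
  rfl

/-- The trace sees only the reduced operator on `A`, so trace bounds for `Φ` survive any memory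
system. -/
theorem trace_ampliate {R : Type*} [Fintype R] [Fintype B] (Φ : Matrix A A ℂ →ₗ[ℂ] Matrix B B ℂ)
    (X : Matrix (R × A) (R × A) ℂ) :
    (ampliate R Φ X).trace = (Φ (∑ r, X.submatrix (Prod.mk r) (Prod.mk r))).trace := by
  rw [map_sum, Matrix.trace_sum, Matrix.trace, Fintype.sum_prod_type]
  rfl

theorem IsCP.sum {ι : Type*} {s : Finset ι} {Φ : ι → Matrix A A ℂ →ₗ[ℂ] Matrix B B ℂ}
    (h : ∀ i ∈ s, IsCP (Φ i)) : IsCP (∑ i ∈ s, Φ i) := fun k X hX => by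
  rw [ampliate_sum]
  exact Matrix.posSemidef_sum _ fun i hi => h i hi k X hX

theorem IsCP.smul {Φ : Matrix A A ℂ →ₗ[ℂ] Matrix B B ℂ} (h : IsCP Φ) {c : ℝ} (hc : 0 ≤ c) :
    IsCP ((c : ℂ) • Φ) := fun k X hX => by
  rw [ampliate_smul]
  exact (h k X hX).smul (by exact_mod_cast hc)

theorem trace_eq_trace_sum_submatrix {R : Type*} [Fintype R] [Fintype A] (X : Matrix (R × A) (R × A) ℂ) :
    X.trace = (∑ r, X.submatrix (Prod.mk r) (Prod.mk r)).trace := by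
  rw [Matrix.trace_sum, Matrix.trace, Fintype.sum_prod_type]
  rfl

variable [Fintype A]

/-- The linear map with a given Choi operator. -/
def choiMap : Matrix (A × B) (A × B) ℂ →ₗ[ℂ] Matrix A A ℂ →ₗ[ℂ] Matrix B B ℂ :=
  LinearMap.mk₂ ℂ (fun C X => Matrix.of fun b b' => ∑ a, ∑ a', X a a' * C (a, b) (a', b'))
    (fun C C' X => by ext; simp [mul_add, Finset.sum_add_distrib])
    (fun c C X => by ext; simp [Finset.mul_sum, mul_left_comm])
    (fun C X X' => by ext; simp [add_mul, Finset.sum_add_distrib])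
    (fun c C X => by ext; simp [Finset.mul_sum, mul_assoc])

theorem choiMap_apply (C : Matrix (A × B) (A × B) ℂ) (X : Matrix A A ℂ) (b b' : B) :
    choiMap C X b b' = ∑ a, ∑ a', X a a' * C (a, b) (a', b') := rfl

variable [Fintype B]

theorem choiMap_choi [DecidableEq A] (T : Channel A B) : choiMap (choi T) = T.toLin := by
  refine LinearMap.ext fun X => ?_
  ext b b'
  conv_rhs => rw [Matrix.matrix_eq_sum_single X]
  simp only [map_sum, Matrix.sum_apply, choiMap_apply, choi, Matrix.of_apply]
  refine Finset.sum_congr rfl fun a _ => Finset.sum_congr rfl fun a' _ => ?_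
  have : Matrix.single a a' (X a a') = X a a' • Matrix.single a a' (1 : ℂ) := by
    simp [Matrix.smul_single]
  rw [this, map_smul]
  rfl

theorem trace_choiMap (C : Matrix (A × B) (A × B) ℂ) (X : Matrix A A ℂ) :
    (choiMap C X).trace = (X * (partialTraceRight C)ᵀ).trace := by
  simp only [Matrix.trace, Matrix.diag, Matrix.mul_apply, Matrix.transpose_apply,
    partialTraceRight, Matrix.of_apply, choiMap_apply, Finset.mul_sum]
  rw [Finset.sum_comm]
  exact Finset.sum_congr rfl fun a _ => Finset.sum_comm

/-- A rank-one Choi operator belongs to a map with a single Kraus operator; `V` is its ampliation.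
-/
theorem isCP_choiMap_vecMulVec (x : A × B → ℂ) :
    IsCP (choiMap (Matrix.vecMulVec x (star x))) := fun k X hX => by
  let V : Matrix (Fin k × B) (Fin k × A) ℂ :=
    Matrix.of fun p q => if p.1 = q.1 then x (q.2, p.2) else 0
  have : ampliate (Fin k) (choiMap (Matrix.vecMulVec x (star x))) X = V * X * Vᴴ := by
    ext p q
    simp only [ampliate, Matrix.of_apply, choiMap_apply, Matrix.vecMulVec_apply, Matrix.mul_apply,
      V, Matrix.conjTranspose_apply, Fintype.sum_prod_type, Finset.sum_mul, Pi.star_apply]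
    rw [Finset.sum_eq_single q.1 (fun r _ hr => by simp [Ne.symm hr]) (by simp)]
    rw [Finset.sum_comm]
    refine Finset.sum_congr rfl fun a' _ => ?_
    rw [Finset.sum_eq_single p.1 (fun r _ hr => by simp [Ne.symm hr]) (by simp)]
    refine Finset.sum_congr rfl fun a _ => ?_
    simp only [if_true]
    ring
  rw [this]
  exact hX.mul_mul_conjTranspose_same V

theorem posSemidef_choi [DecidableEq A] (T : Channel A B) : (choi T).PosSemidef := by
  let e := Fintype.equivFin A
  -- The unnormalised maximally entangled vector, with the reference relabelled by `Fin` to match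
  -- the definition of complete positivity.
  let y : Fin (Fintype.card A) × A → ℂ := fun p => if p.1 = e p.2 then 1 else 0
  have h := T.completelyPositive _ _ (Matrix.posSemidef_vecMulVec_self_star y)
  convert h.submatrix (fun p : A × B => (e p.1, p.2)) using 1
  ext p q
  refine congrArg (fun Y => T.toLin Y p.2 q.2) ?_
  ext a a'
  simp [Matrix.vecMulVec_apply, y, Matrix.single_apply]
  grind

/-- `T` and `M` arise from a common family of completely positive maps by weighting with `w` and
with `1`, such that the relative entropy of the weights is at most `c` on every input. -/
def HasReverseTest (T M : Matrix A A ℂ →ₗ[ℂ] Matrix B B ℂ) (c : ℝ) : Prop :=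
  ∃ (ι : Type (max u v)) (_ : Fintype ι) (Φ : ι → Matrix A A ℂ →ₗ[ℂ] Matrix B B ℂ) (w : ι → ℝ),
    (∀ i, IsCP (Φ i)) ∧ (∀ i, 0 ≤ w i) ∧ ∑ i, Φ i = M ∧ ∑ i, (w i : ℂ) • Φ i = T ∧
    ∀ X : Matrix A A ℂ, X.PosSemidef →
      ∑ i, w i * Real.log (w i) * (Φ i X).trace.re ≤ c * X.trace.re

/-- On input `X` the weighted entropy is `Tr (X Zᵀ)`, with `Z` the partial trace of `bsOperator`;
the operator norm in `bsDiv` bounds it uniformly in `X`. -/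
theorem hasReverseTest_of_bsDiv_ne_top [DecidableEq A] [DecidableEq B] {T M : Channel A B}
    (h : bsDiv T M ≠ ⊤) :
    ∃ c : ℝ, bsDiv T M = c ∧ HasReverseTest T.toLin M.toLin c := by
  have hs : supp (choi T) ≤ supp (choi M) := by
    by_contra hs
    exact h (if_neg hs)
  refine ⟨_, if_pos hs, ?_⟩
  obtain ⟨w, x, hw, h1, h2, h3⟩ := exists_reverse_test (posSemidef_choi T) (posSemidef_choi M) hs
  refine ⟨A × B, inferInstance, fun k => choiMap (Matrix.vecMulVec (x k) (star (x k))), w,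
    fun k => isCP_choiMap_vecMulVec _, hw, ?_, ?_, fun X hX => ?_⟩
  · rw [← map_sum, h1, choiMap_choi]
  · simp only [← map_smul]
    rw [← map_sum, h2, choiMap_choi]
  · refine le_trans (le_of_eq ?_) (re_trace_mul_transpose_le hX _)
    rw [← h3, ← trace_choiMap, map_sum, LinearMap.sum_apply, Matrix.trace_sum, Complex.re_sum]
    refine Finset.sum_congr rfl fun k _ => ?_
    rw [map_smul, LinearMap.smul_apply, Matrix.trace_smul, smul_eq_mul, Complex.re_ofReal_mul]

/-- Reverse tests against a fixed second map can be mixed. -/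
theorem HasReverseTest.convexCombination {T T' M : Matrix A A ℂ →ₗ[ℂ] Matrix B B ℂ} {c c' : ℝ}
    (h : HasReverseTest T M c) (h' : HasReverseTest T' M c') {s t : ℝ} (hs : 0 ≤ s) (ht : 0 ≤ t)
    (hst : s + t = 1) :
    HasReverseTest ((s : ℂ) • T + (t : ℂ) • T') M (s * c + t * c') := by
  obtain ⟨ι, _, Φ, w, hΦ, hw, hM, hT, hc⟩ := h
  obtain ⟨ι', _, Φ', w', hΦ', hw', hM', hT', hc'⟩ := h'
  -- Scaling the maps rather than the weights keeps every logarithm unchanged, so the entropies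
  -- combine linearly.
  refine ⟨ι ⊕ ι', inferInstance, Sum.elim (fun i => (s : ℂ) • Φ i) (fun i => (t : ℂ) • Φ' i),
    Sum.elim w w', ?_, ?_, ?_, ?_, fun X hX => ?_⟩
  · rintro (i | i)
    exacts [(hΦ i).smul hs, (hΦ' i).smul ht]
  · rintro (i | i)
    exacts [hw i, hw' i]
  · simp only [Fintype.sum_sum_type, Sum.elim_inl, Sum.elim_inr, ← Finset.smul_sum, hM, hM']
    rw [← add_smul]
    norm_cast
    simp [hst]
  · simp only [Fintype.sum_sum_type, Sum.elim_inl, Sum.elim_inr, smul_comm _ (s : ℂ),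
      smul_comm _ (t : ℂ), ← Finset.smul_sum, hT, hT']
  · have e : ∀ (r z : ℝ) (Ψ : Matrix A A ℂ →ₗ[ℂ] Matrix B B ℂ),
        z * ((r : ℂ) • Ψ X).trace.re = r * (z * (Ψ X).trace.re) := fun r z Ψ => by
      rw [Matrix.trace_smul, smul_eq_mul, Complex.re_ofReal_mul]
      ring
    simp only [Fintype.sum_sum_type, Sum.elim_inl, Sum.elim_inr, LinearMap.smul_apply, e,
      ← Finset.mul_sum]
    have h1 := mul_le_mul_of_nonneg_left (hc X hX) hs
    have h2 := mul_le_mul_of_nonneg_left (hc' X hX) ht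
    linarith

end ReverseTest

/-! ### Adaptive protocols and the exponential strong converse. -/

section Strategies

variable {A : Type u} {B : Type v} [Fintype A] [Fintype B]

/-- The final operator of a protocol in which the unknown channel is replaced by a linear map. -/
def Protocol.run (Φ : Matrix A A ℂ →ₗ[ℂ] Matrix B B ℂ) :
    {n d : ℕ} → Protocol A B n d → Matrix (Fin d × B) (Fin d × B) ℂ
  | _, _, .start ρ _ => ampliate _ Φ ρ
  | _, _, .step P S => ampliate _ Φ (S.toLin (P.run Φ))

theorem Protocol.finalState_eq_run (N : Channel A B) {n d : ℕ} (P : Protocol A B n d) :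
    P.finalState N = P.run N.toLin := by
  induction P with
  | start ρ hρ => rfl
  | step P S ih => rw [Protocol.finalState, Protocol.run, ih]

theorem Protocol.trace_run {T : Matrix A A ℂ →ₗ[ℂ] Matrix B B ℂ}
    (hT : ∀ X, (T X).trace = X.trace) {n d : ℕ} (P : Protocol A B n d) :
    (P.run T).trace = 1 := by
  induction P with
  | start ρ hρ => rw [Protocol.run, trace_ampliate, hT, ← trace_eq_trace_sum_submatrix, hρ.2]
  | step P S ih =>
    rw [Protocol.run, trace_ampliate, hT, ← trace_eq_trace_sum_submatrix, S.tracePreserving, ih]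

theorem trace_ampliate_le {R : Type*} [Fintype R] {Φ : Matrix A A ℂ →ₗ[ℂ] Matrix B B ℂ} {c : ℝ}
    (h : ∀ X : Matrix A A ℂ, X.PosSemidef → (Φ X).trace.re ≤ c * X.trace.re)
    {X : Matrix (R × A) (R × A) ℂ} (hX : X.PosSemidef) :
    (ampliate R Φ X).trace.re ≤ c * X.trace.re := by
  rw [trace_ampliate, trace_eq_trace_sum_submatrix X]
  exact h _ (Matrix.posSemidef_sum _ fun r _ => hX.submatrix _)

theorem Protocol.posSemidef_run {Φ : Matrix A A ℂ →ₗ[ℂ] Matrix B B ℂ} (hΦ : IsCP Φ) {n d : ℕ}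
    (P : Protocol A B n d) : (P.run Φ).PosSemidef := by
  induction P with
  | start ρ hρ => exact hΦ _ _ hρ.1
  | step P S ih => exact hΦ _ _ (IsCP.posSemidef_map S.completelyPositive ih)

/-- The intermediate channels preserve the trace, so one factor `c` per call accumulates. -/
theorem Protocol.trace_run_le {Φ : Matrix A A ℂ →ₗ[ℂ] Matrix B B ℂ} (hΦ : IsCP Φ) {c : ℝ}
    (hc : 0 ≤ c) (h : ∀ X : Matrix A A ℂ, X.PosSemidef → (Φ X).trace.re ≤ c * X.trace.re)
    {n d : ℕ} (P : Protocol A B n d) : (P.run Φ).trace.re ≤ c ^ n := by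
  induction P with
  | start ρ hρ => simpa [hρ.2, Protocol.run] using trace_ampliate_le h hρ.1
  | step P S ih =>
    refine (trace_ampliate_le h
      (IsCP.posSemidef_map S.completelyPositive (P.posSemidef_run hΦ))).trans ?_
    rw [S.tracePreserving, pow_succ']
    exact mul_le_mul_of_nonneg_left ih hc

/-- The final operator of a protocol, for a weighted sum of completely positive maps, is a sum over
the sequences of the maps that act in the successive calls. -/
theorem Protocol.exists_run_sum_smul {ι : Type*} [Fintype ι]
    {Φ : ι → Matrix A A ℂ →ₗ[ℂ] Matrix B B ℂ} (hΦ : ∀ i, IsCP (Φ i)) {n d : ℕ}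
    (P : Protocol A B n d) :
    ∃ ω : (Fin n → ι) → Matrix (Fin d × B) (Fin d × B) ℂ, (∀ f, (ω f).PosSemidef) ∧
      ∀ w : ι → ℝ, P.run (∑ i, (w i : ℂ) • Φ i) =
        ∑ f, ((∏ j, w (f j) : ℝ) : ℂ) • ω f := by
  induction P with
  | start ρ hρ =>
    refine ⟨fun f => ampliate _ (Φ (f 0)) ρ, fun f => hΦ _ _ _ hρ.1, fun w => ?_⟩
    rw [Protocol.run, ampliate_sum, ← (Equiv.funUnique (Fin 1) ι).sum_comp]
    refine Finset.sum_congr rfl fun f _ => ?_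
    simp [ampliate_smul]
  | step P S ih =>
    obtain ⟨ω, hω, h⟩ := ih
    -- Sequences run backwards in time: index `0` is the latest call. The operators `ω` do not
    -- depend on `w`.
    refine ⟨fun f => ampliate _ (Φ (f 0)) (S.toLin (ω (Fin.tail f))),
      fun f => hΦ _ _ _ (IsCP.posSemidef_map S.completelyPositive (hω _)), fun w => ?_⟩
    rw [Protocol.run, h, ← (Fin.consEquiv fun _ => ι).sum_comp, Fintype.sum_prod_type,
      ampliate_sum]
    refine Finset.sum_congr rfl fun i _ => ?_
    rw [map_sum, ampliate_map_sum]
    refine Finset.sum_congr rfl fun f _ => ?_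
    rw [map_smul, ampliate_map_smul, ampliate_smul, smul_smul]
    simp [Fin.consEquiv, Fin.prod_univ_succ, mul_comm]

theorem re_trace_mul_nonneg {n : Type*} [Fintype n] [DecidableEq n] {L X : Matrix n n ℂ}
    (hL : L.PosSemidef) (hX : X.PosSemidef) : 0 ≤ (L * X).trace.re := by
  have h := (hX.mul_mul_conjTranspose_same (cfc Real.sqrt L)).trace_nonneg
  rw [(isHermitian_cfc L Real.sqrt).eq, mul_assoc, Matrix.trace_mul_comm, mul_assoc,
    cfc_sqrt_mul_cfc_sqrt hL, Matrix.trace_mul_comm] at h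
  exact (Complex.nonneg_iff.1 h).1

/-- Markov's inequality in pointwise form: above the threshold `exp b`, one has `x ^ s ≥ exp (s *
b)`. -/
theorem le_exp_add_exp_mul_rpow {x s : ℝ} (hx : 0 ≤ x) (hs : 0 ≤ s) (b : ℝ) :
    x ≤ Real.exp b + Real.exp (-(s * b)) * (x * x ^ s) := by
  have hpos : 0 ≤ Real.exp (-(s * b)) * (x * x ^ s) := by positivity
  rcases le_or_gt x (Real.exp b) with h | h
  · linarith
  · have h1 : Real.exp (s * b) ≤ x ^ s := by
      rw [mul_comm, Real.exp_mul]
      exact Real.rpow_le_rpow (Real.exp_pos _).le h.le hs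
    have h2 : x ≤ Real.exp (-(s * b)) * (x * x ^ s) := by
      calc x = Real.exp (-(s * b)) * (x * Real.exp (s * b)) := by
            rw [mul_left_comm, ← Real.exp_add]
            simp
        _ ≤ _ := by gcongr
    linarith [Real.exp_pos b]

/-- Second-order expansion of `x ^ (1 + s)` at `s = 0`, from `exp y ≤ 1 + y + y ^ 2` for `|y| ≤ 1`.
-/
theorem mul_rpow_le {x s K : ℝ} (hx : 0 ≤ x) (hs : 0 ≤ s) (hK : |Real.log x| ≤ K)
    (hsK : s * K ≤ 1) :
    x * x ^ s ≤ x + s * (x * Real.log x) + s ^ 2 * K ^ 2 * x := by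
  rcases hx.eq_or_lt with rfl | hx
  · simp
  · have h1 : |s * Real.log x| ≤ s * K := by
      rw [abs_mul, abs_of_nonneg hs]
      gcongr
    have h2 := (abs_le.1 (Real.abs_exp_sub_one_sub_id_le (h1.trans hsK))).2
    have h3 : (s * Real.log x) ^ 2 ≤ s ^ 2 * K ^ 2 := by
      rw [← mul_pow, ← sq_abs]
      gcongr
    rw [Real.rpow_def_of_pos hx, mul_comm (Real.log x)]
    nlinarith

/-- Exponential strong converse: if `T` and `M` have a reverse test of rate `c < a`, then no
protocol has a test that is accepted under `T` with a probability exceeding `exp (n a)` times the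
one under `M` by more than an exponentially small amount. -/
theorem HasReverseTest.exists_exp_bound [DecidableEq B] {T M : Matrix A A ℂ →ₗ[ℂ] Matrix B B ℂ}
    {c a : ℝ} (h : HasReverseTest T M c) (hT : ∀ X, (T X).trace = X.trace) (hca : c < a) :
    ∃ δ : ℝ, 0 < δ ∧ ∀ (n d : ℕ) (P : Protocol A B n d)
      (L : Matrix (Fin d × B) (Fin d × B) ℂ), IsTest L →
      (L * P.run T).trace.re ≤
        Real.exp (n * a) * (L * P.run M).trace.re + Real.exp (-(n * δ)) := by
  obtain ⟨ι, _, Φ, w, hΦ, hw, hM, hTw, hc⟩ := h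
  obtain ⟨K, hK0, hK⟩ : ∃ K : ℝ, 0 ≤ K ∧ ∀ i, |Real.log (w i)| ≤ K :=
    ⟨∑ i, |Real.log (w i)|, by positivity, fun i =>
      Finset.single_le_sum (f := fun i => |Real.log (w i)|) (fun _ _ => abs_nonneg _)
        (Finset.mem_univ i)⟩
  -- The quadratic error `s² K²` may consume at most half of the gap `s (a - c)`.
  obtain ⟨s, hs, hsK, hsK2⟩ : ∃ s : ℝ, 0 < s ∧ s * K ≤ 1 ∧ s * K ^ 2 ≤ (a - c) / 2 := by
    have hac : 0 < a - c := sub_pos.2 hca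
    refine ⟨min (1 / (K + 1)) ((a - c) / 2 / (K ^ 2 + 1)), by positivity, ?_, ?_⟩
    · calc _ ≤ 1 / (K + 1) * K := by gcongr; exact min_le_left _ _
        _ ≤ 1 := by rw [div_mul_eq_mul_div, div_le_one (by positivity)]; linarith
    · calc _ ≤ (a - c) / 2 / (K ^ 2 + 1) * K ^ 2 := by gcongr; exact min_le_right _ _
        _ ≤ (a - c) / 2 := by
          rw [div_mul_eq_mul_div, div_le_iff₀ (by positivity)]
          gcongr
          linarith
  -- Tilting by the likelihood ratio to the power `s`: running the tilted map yields the moment of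
  -- order `1 + s`.
  let w' : ι → ℝ := fun i => w i * w i ^ s
  have hw' (i : ι) : 0 ≤ w' i := mul_nonneg (hw i) (Real.rpow_nonneg (hw i) s)
  have hCP : IsCP (∑ i, (w' i : ℂ) • Φ i) := IsCP.sum fun i _ => (hΦ i).smul (hw' i)
  have htr (z : ι → ℝ) (X : Matrix A A ℂ) :
      ((∑ i, (z i : ℂ) • Φ i) X).trace.re = ∑ i, z i * (Φ i X).trace.re := by
    rw [LinearMap.sum_apply, Matrix.trace_sum, Complex.re_sum]
    refine Finset.sum_congr rfl fun i _ => ?_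
    rw [LinearMap.smul_apply, Matrix.trace_smul, smul_eq_mul, Complex.re_ofReal_mul]
  have hbound (X : Matrix A A ℂ) (hX : X.PosSemidef) :
      ((∑ i, (w' i : ℂ) • Φ i) X).trace.re ≤ Real.exp (s * (c + (a - c) / 2)) * X.trace.re := by
    have hX0 : 0 ≤ X.trace.re := (Complex.nonneg_iff.1 hX.trace_nonneg).1
    have h1 : ∑ i, w i * (Φ i X).trace.re = X.trace.re := by rw [← htr, hTw, hT]
    calc ((∑ i, (w' i : ℂ) • Φ i) X).trace.re = ∑ i, w' i * (Φ i X).trace.re := htr _ _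
      _ ≤ ∑ i, (w i * (Φ i X).trace.re + s * (w i * Real.log (w i) * (Φ i X).trace.re) +
            s ^ 2 * K ^ 2 * (w i * (Φ i X).trace.re)) := by
          refine Finset.sum_le_sum fun i _ => ?_
          have h0 : 0 ≤ (Φ i X).trace.re :=
            (Complex.nonneg_iff.1 ((hΦ i).posSemidef_map hX).trace_nonneg).1
          have := mul_le_mul_of_nonneg_right (mul_rpow_le (hw i) hs.le (hK i) hsK) h0
          linarith
      _ ≤ (1 + s * c + s ^ 2 * K ^ 2) * X.trace.re := by
          rw [Finset.sum_add_distrib, Finset.sum_add_distrib, ← Finset.mul_sum, ← Finset.mul_sum,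
            h1]
          have := mul_le_mul_of_nonneg_left (hc X hX) hs.le
          linarith
      _ ≤ _ := by
          refine mul_le_mul_of_nonneg_right ?_ hX0
          have := mul_le_mul_of_nonneg_left hsK2 hs.le
          have := Real.add_one_le_exp (s * (c + (a - c) / 2))
          linarith
  refine ⟨s * ((a - c) / 2), by have := sub_pos.2 hca; positivity, fun n d P L hL => ?_⟩
  obtain ⟨ω, hω, hrun⟩ := P.exists_run_sum_smul hΦ
  have hLrun (z : ι → ℝ) (Q : Matrix (Fin d × B) (Fin d × B) ℂ) :
      (Q * P.run (∑ i, (z i : ℂ) • Φ i)).trace.re =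
        ∑ f : Fin n → ι, (∏ j, z (f j)) * (Q * ω f).trace.re := by
    rw [hrun, Finset.mul_sum, Matrix.trace_sum, Complex.re_sum]
    refine Finset.sum_congr rfl fun f _ => ?_
    rw [Matrix.mul_smul, Matrix.trace_smul, smul_eq_mul, Complex.re_ofReal_mul]
  have hMrun : (L * P.run M).trace.re = ∑ f : Fin n → ι, (L * ω f).trace.re := by
    have := hLrun (fun _ => 1) L
    simpa [hM] using this
  have hW := P.trace_run_le hCP (Real.exp_pos _).le hbound
  rw [← one_mul (P.run _), hLrun w' 1] at hW
  rw [← hTw, hLrun, hMrun]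
  calc ∑ f : Fin n → ι, (∏ j, w (f j)) * (L * ω f).trace.re
      ≤ ∑ f : Fin n → ι, (Real.exp (n * a) * (L * ω f).trace.re +
          Real.exp (-(s * (n * a))) * ((∏ j, w' (f j)) * (1 * ω f).trace.re)) := by
        refine Finset.sum_le_sum fun f _ => ?_
        have h0 : 0 ≤ (L * ω f).trace.re := re_trace_mul_nonneg hL.1 (hω f)
        have h1 : (L * ω f).trace.re ≤ (1 * ω f).trace.re := by
          have := re_trace_mul_nonneg hL.2 (hω f)
          rw [sub_mul, Matrix.trace_sub, Complex.sub_re] at this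
          linarith
        have hprod : ∏ j, w' (f j) = (∏ j, w (f j)) * (∏ j, w (f j)) ^ s := by
          rw [← Real.finsetProd_rpow _ _ fun j _ => hw (f j), ← Finset.prod_mul_distrib]
        have h2 := mul_le_mul_of_nonneg_right (le_exp_add_exp_mul_rpow
          (Finset.univ.prod_nonneg fun j _ => hw (f j)) hs.le (n * a)) h0
        rw [← hprod] at h2
        have h3 : 0 ≤ ∏ j, w' (f j) := Finset.prod_nonneg fun j _ => hw' (f j)
        calc _ ≤ _ := h2
          _ = Real.exp (n * a) * (L * ω f).trace.re +
            Real.exp (-(s * (n * a))) * ((∏ j, w' (f j)) * (L * ω f).trace.re) := by ring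
          _ ≤ _ := by gcongr
    _ = Real.exp (n * a) * ∑ f : Fin n → ι, (L * ω f).trace.re +
          Real.exp (-(s * (n * a))) * ∑ f : Fin n → ι, (∏ j, w' (f j)) * (1 * ω f).trace.re := by
        rw [Finset.sum_add_distrib, Finset.mul_sum, Finset.mul_sum]
    _ ≤ Real.exp (n * a) * ∑ f : Fin n → ι, (L * ω f).trace.re +
          Real.exp (-(s * (n * a))) * Real.exp (s * (c + (a - c) / 2)) ^ n := by gcongr
    -- The exponents add up to `-n s (a - c) / 2 = -n δ`.
    _ = _ := by
        rw [← Real.exp_nat_mul, ← Real.exp_add]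
        ring_nf

end Strategies

/-! ### From the strong converse to error exponents. -/

section SphereBound

variable {A : Type u} {B : Type v} [Fintype A] [Fintype B] [DecidableEq B]

theorem errExponent_of_pos (n : ℕ) {x : ℝ} (hx : 0 < x) :
    errExponent n x = ((-Real.log x / n : ℝ) : EReal) := by
  rw [errExponent, ENNReal.log_ofReal_of_pos hx, EReal.coe_div, EReal.coe_neg]
  rfl

theorem le_exp_of_le_errExponent {n : ℕ} (hn : 0 < n) {r x : ℝ}
    (h : (r : EReal) ≤ errExponent n x) : x ≤ Real.exp (-(n * r)) := by
  rcases le_or_gt x 0 with hx | hx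
  · exact hx.trans (Real.exp_pos _).le
  · rw [errExponent_of_pos n hx] at h
    have h1 : r ≤ -Real.log x / n := by exact_mod_cast h
    rw [le_div_iff₀ (by exact_mod_cast hn)] at h1
    rw [← Real.log_le_iff_le_exp hx]
    linarith

theorem errExponent_le_of_exp_le {n : ℕ} (hn : 0 < n) {r x : ℝ}
    (h : Real.exp (-(n * r)) ≤ x) : errExponent n x ≤ r := by
  have hx : 0 < x := (Real.exp_pos _).trans_le h
  rw [errExponent_of_pos n hx]
  have h1 : -Real.log x / n ≤ r := by
    rw [div_le_iff₀ (by exact_mod_cast hn)]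
    have := (Real.le_log_iff_exp_le hx).2 h
    linarith
  exact_mod_cast h1

theorem IsTest.one_sub {ι : Type*} [Fintype ι] [DecidableEq ι] {L : Matrix ι ι ℂ}
    (h : IsTest L) : IsTest (1 - L) := ⟨h.2, by rw [sub_sub_cancel]; exact h.1⟩

theorem tendsto_exp_neg_nat_mul {δ : ℝ} (hδ : 0 < δ) :
    Tendsto (fun n : ℕ => Real.exp (-(n * δ))) atTop (nhds 0) :=
  Real.tendsto_exp_neg_atTop_nhds_zero.comp
    (tendsto_natCast_atTop_atTop.atTop_mul_const hδ)

/-- A map `T` with reverse tests of rate below `r` with `M`, and of rate `c'` with `N`, bounds the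
Hoeffding exponent of `N` and `M` at `r` by `c'`. -/
theorem hoeffdingUpper_le_of_hasReverseTest (N M : Channel A B)
    {T : Matrix A A ℂ →ₗ[ℂ] Matrix B B ℂ} (hT : ∀ X, (T X).trace = X.trace) {r c c' : ℝ} (hM : HasReverseTest T M.toLin c)
    (hcr : c < r) (hN : HasReverseTest T N.toLin c') : hoeffdingUpper r N M ≤ c' := by
  rw [← EReal.le_of_forall_lt_iff_le]
  intro z hz
  replace hz : c' < z := by exact_mod_cast hz
  obtain ⟨a, hca, har⟩ := exists_between hcr
  obtain ⟨a', hca', haz⟩ := exists_between hz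
  obtain ⟨δ, hδ, h1⟩ := hM.exists_exp_bound hT hca
  obtain ⟨δ', hδ', h2⟩ := hN.exists_exp_bound hT hca'
  -- Under `T` the two outcomes have total probability one. The first three terms are the losses
  -- from the type II constraint and the two strong converses; the fourth is the part that must
  -- remain for the type I error.
  have hlim := (((tendsto_exp_neg_nat_mul (sub_pos.2 har)).add (tendsto_exp_neg_nat_mul hδ)).add
    (tendsto_exp_neg_nat_mul hδ')).add (tendsto_exp_neg_nat_mul (sub_pos.2 haz))
  simp only [add_zero] at hlim
  refine limsup_le_of_le (h := ?_)
  filter_upwards [hlim.eventually_le_const one_pos, eventually_gt_atTop 0] with n hsmall hn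
  refine sSup_le ?_
  rintro _ ⟨d, P, L, hL, hr, rfl⟩
  refine errExponent_le_of_exp_le hn ?_
  have hβ := le_exp_of_le_errExponent hn hr
  rw [typeII, Protocol.finalState_eq_run] at hβ
  rw [typeI, Protocol.finalState_eq_run]
  have hT1 : (L * P.run T).trace.re + ((1 - L) * P.run T).trace.re = 1 := by
    rw [← Complex.add_re, ← Matrix.trace_add, ← add_mul, add_sub_cancel, one_mul, P.trace_run hT,
      Complex.one_re]
  have h3 := h1 n d P L hL
  have h4 := h2 n d P (1 - L) hL.one_sub
  have h5 : Real.exp (n * a) * (L * P.run M.toLin).trace.re ≤ Real.exp (-(n * (r - a))) := by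
    refine (mul_le_mul_of_nonneg_left hβ (Real.exp_pos _).le).trans (le_of_eq ?_)
    rw [← Real.exp_add]
    ring_nf
  have h6 : Real.exp (-(n * (z - a'))) ≤
      Real.exp (n * a') * ((1 - L) * P.run N.toLin).trace.re := by linarith
  refine le_of_mul_le_mul_left (le_trans (le_of_eq ?_) h6) (Real.exp_pos (n * a'))
  rw [← Real.exp_add]
  ring_nf

end SphereBound

end QDisc

/-! ### The boundary case, by perturbation of `T`. -/

theorem mainTheorem9 {A B : Type*} [Fintype A] [DecidableEq A] [Nonempty A]
    [Fintype B] [DecidableEq B] [Nonempty B]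
    (N M : QDisc.Channel A B) (r : ℝ) (hr : 0 < r)
    (hcrit : (r : EReal) ≠
      ⨅ (T : QDisc.Channel A B) (_ : QDisc.bsDiv T N < ⊤), QDisc.bsDiv T M) :
    QDisc.hoeffdingUpper r N M ≤
      ⨅ (T : QDisc.Channel A B) (_ : QDisc.bsDiv T M ≤ (r : EReal)), QDisc.bsDiv T N := by
  refine le_iInf₂ fun T hTM => ?_
  by_cases hTN : QDisc.bsDiv T N = ⊤
  · rw [hTN]
    exact le_top
  -- `T` itself competes in the infimum, so `r₀ ≤ r`, and `r ≠ r₀` makes this strict.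
  have hlt : ⨅ (T : QDisc.Channel A B) (_ : QDisc.bsDiv T N < ⊤), QDisc.bsDiv T M < (r : EReal) :=
    lt_of_le_of_ne ((iInf₂_le T (lt_top_iff_ne_top.2 hTN)).trans hTM) hcrit.symm
  simp only [iInf_lt_iff] at hlt
  obtain ⟨T', hTN', hTM'⟩ := hlt
  obtain ⟨c, hc, hcM⟩ :=
    QDisc.hasReverseTest_of_bsDiv_ne_top (hTM.trans_lt (EReal.coe_lt_top r)).ne
  obtain ⟨c', hc', hcN⟩ := QDisc.hasReverseTest_of_bsDiv_ne_top hTN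
  obtain ⟨e, he, heM⟩ := QDisc.hasReverseTest_of_bsDiv_ne_top (hTM'.trans (EReal.coe_lt_top r)).ne
  obtain ⟨e', he', heN⟩ := QDisc.hasReverseTest_of_bsDiv_ne_top hTN'.ne
  have hcr : c ≤ r := by
    rw [hc] at hTM
    exact_mod_cast hTM
  have her : e < r := by
    rw [he] at hTM'
    exact_mod_cast hTM'
  rw [hc', ← EReal.le_of_forall_lt_iff_le]
  intro z hz
  replace hz : 0 < z - c' := sub_pos.2 (by exact_mod_cast hz)
  -- Any `t > 0` pushes the rate against `M` below `r`; this bound on `t` keeps the rate `c' + t (e'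
  -- - c')` against `N` at most `z`.
  obtain ⟨t, ht0, ht1, htz⟩ : ∃ t : ℝ, 0 < t ∧ t ≤ 1 ∧ t * |e' - c'| ≤ z - c' := by
    refine ⟨min 1 ((z - c') / (|e' - c'| + 1)), by positivity, min_le_left _ _, ?_⟩
    calc _ ≤ (z - c') / (|e' - c'| + 1) * |e' - c'| := by gcongr; exact min_le_right _ _
      _ ≤ z - c' := by
        rw [div_mul_eq_mul_div, div_le_iff₀ (by positivity)]
        gcongr
        linarith
  have hs0 : 0 ≤ 1 - t := sub_nonneg.2 ht1
  have hmix : (1 - t) * c + t * e < r := by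
    have h1 := mul_le_mul_of_nonneg_left hcr hs0
    have h2 := mul_lt_mul_of_pos_left her ht0
    linarith
  have hle := QDisc.hoeffdingUpper_le_of_hasReverseTest N M (r := r)
    (T := ((1 - t : ℝ) : ℂ) • T.toLin + (t : ℂ) • T'.toLin) (fun X => by
      simp [Matrix.trace_add, Matrix.trace_smul, T.tracePreserving, T'.tracePreserving]
      ring)
    (hcM.convexCombination heM hs0 ht0.le (sub_add_cancel 1 t)) hmix
    (hcN.convexCombination heN hs0 ht0.le (sub_add_cancel 1 t))
  refine hle.trans ?_
  have := mul_le_mul_of_nonneg_left (le_abs_self (e' - c')) ht0.le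
  exact_mod_cast (by linarith : (1 - t) * c' + t * e' ≤ z)
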